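/- **Conventions.** Fix a field $K$. Digraphs $G=(V(G),E(G))$ are simple (no self-loops), with arbitrary vertex sets; $v\to w$ means $(v,w)\in E(G)$, and $v\,\vec{=}\,w$ means $v=w$ or $v\to w$. A directed $k$-clique is a tuple $v_0\dots v_{k-1}$ of distinct vertices with $v_i\to v_j$ for all $i<j$. $\mathrm{dFl}(G)$ is the ordered simplicial complex of all directed cliques of $G$, and $C_k(G)=\Omega_k(\mathrm{dFl}(G))$ is the $K$-vector space with basis the directed $(k+1)$-cliques, with boundary $\partial(v_0\dots v_k)=\sum_i(-1)^i v_0\dots\hat v_i\dots v_k$. A weighted digraph carries in addition a weighting $w:E(G)\to(0,\infty)$. A path $i\leadsto j$ is a non-empty finite sequence of composable edges from $i$ to $j$; its length is the sum of the weights. For $t\ge 0$, $\mathrm{SP}(G)_t$ is the simple digraph on $V(G)$ with an edge $(i,j)$, $i\ne j$, iff there is a path $i\leadsto j$ in $G$ of length $\le t$. **Grounded persistent directed flag homology.** For $t\in[0,\infty)$ consider the chain complex $$\cdots\to C_3(\mathrm{SP}(G)_t)\to C_2(\mathrm{SP}(G)_t)\to C_1(G\cup\mathrm{SP}(G)_t)\to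 C_0(G\cup\mathrm{SP}(G)_t),$$ with boundary maps $\partial$ (in degree $2$ followed by the inclusion). With the inclusions for $s\le t$ these form a functor from the poset $[0,\infty)$ to chain complexes, and $\mathcal H(G)$ denotes its first homology, a functor from $[0,\infty)$ to $K$-vector spaces. **Interleaving distance.** For $\delta\ge0$ and functors $M,N$ on $[0,\infty)$, a $\delta$-interleaving is a pair of natural transformations $\varphi_t:M(t)\to N(t+\delta)$, $\psi_t:N(t)\to M(t+\delta)$ with $\psi_{t+\delta}\varphi_t=M(t\le t+2\delta)$ and $\varphi_{t+\delta}\psi_t=N(t\le t+2\delta)$ for all $t$; $d_I(M,N)\in[0,\infty]$ is the infimum of all $\delta\ge 0$ for which a $\delta$-interleaving exists. **Homotopies.** A vertex map $f:V(G)\to V(H)$ is a weak digraph map if $v\to w$ implies $f(v)\,\vec{=}\,f(w)$; it is triangle-collapsing if moreover, for every directed $3$-clique $v_0v_1v_2$ of $G$, $f(v_0)=f(v_2)$ implies $f(v_0)=f(v_1)=f(v_2)$. For $A\subseteq V(G)$ and triangle-collapsing maps $f,g:G\to H$ there is a one-step homotopy from $f$ to $g$ relative $A$ if (i) $x\,\vec{=}\,y$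 implies $f(x)\,\vec{=}\,g(y)$; (ii) $x\to y$ and $f(x)=g(y)$ imply $f(x)=f(y)=g(x)=g(y)$; and (iii) $f|_A=g|_A$. Being $\mathrm{dFl}$-homotopic relative $A$ is the equivalence relation on triangle-collapsing maps $G\to H$ generated by one-step homotopies relative $A$. **Grounded interleavings.** Let $G,H$ be weighted digraphs, $\delta\ge 0$, $f:V(G)\to V(H)$, $g:V(H)\to V(G)$. - $f$ is path-collapsing if, whenever $i,j,k$ are distinct vertices of $G$ with paths $i\leadsto j\leadsto k$ and $f(i)=f(k)$, then $f(i)=f(j)=f(k)$. - $f$ is $\delta$-shifting if, for every $t\ge0$, it is a weak digraph map $\mathrm{SP}(G)_t\to\mathrm{SP}(H)_{t+\delta}$ and $G\cup\mathrm{SP}(G)_t\to H\cup\mathrm{SP}(H)_{t+\delta}$. - Let $V_{\mathrm{fix}}(g,f)=\{v\in V(G): g(f(v))=v\}$ and let $G_{\mathrm{diff}}(g,f)$ be the digraph on $V(G)$ whose edges are the $(i,j)\in E(G)$ with $(gf(i),gf(j))\ne(i,j)$. The pair $(g,f)$ has grounded $\mathrm{dFl}$-codistortion $\le\delta$ if $\mathrm{id}$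 and $g\circ f$ are triangle-collapsing digraph maps $G_{\mathrm{diff}}(g,f)\to\mathrm{SP}(G)_{2\delta}$ that are $\mathrm{dFl}$-homotopic relative $V_{\mathrm{fix}}(g,f)$. - $f,g$ form a $\delta$-grounded $\mathrm{dFl}$-interleaving if both are path-collapsing and $\delta$-shifting, and $(g,f)$ and $(f,g)$ both have grounded $\mathrm{dFl}$-codistortion $\le\delta$. **Theorem.** If there is a $\delta$-grounded $\mathrm{dFl}$-interleaving between the weighted digraphs $G$ and $H$, then $$d_I\big(\mathcal H(G),\mathcal H(H)\big)\le\delta .$$ -/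

import Mathlib

open CategoryTheory
open scoped NNReal ENNReal

universe u v

noncomputable section

namespace GroundedFlag

/-! ### Elementary paths and path complexes -/

/-- An elementary `k`-path on `V`: a sequence `v₀ … v_k` of vertices. -/
abbrev ElemPath (V : Type u) (k : ℕ) : Type u := Fin (k + 1) → V

/-- The path `v₀ … v̂ᵢ … v_{k+1}`. -/
def ElemPath.face {V : Type u} {k : ℕ} (p : ElemPath V (k + 1)) (i : Fin (k + 2)) :
    ElemPath V k :=
  fun j => p (i.succAbove j)

/-- A path is regular if no two consecutive vertices coincide. -/
def ElemPath.IsRegular {V : Type u} {k : ℕ} (p : ElemPath V k) : Prop :=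
  ∀ i : Fin k, p i.castSucc ≠ p i.succ

/-- A path complex on `V`: contains all singletons and is closed under truncation at either end. -/
structure PathComplex (V : Type u) where
  paths : ∀ k : ℕ, Set (ElemPath V k)
  singleton_mem : ∀ v : V, (fun _ => v) ∈ paths 0
  tail_mem : ∀ (k : ℕ) (p : ElemPath V (k + 1)), p ∈ paths (k + 1) →
    (fun j : Fin (k + 1) => p j.succ) ∈ paths k
  init_mem : ∀ (k : ℕ) (p : ElemPath V (k + 1)), p ∈ paths (k + 1) →
    (fun j : Fin (k + 1) => p j.castSucc) ∈ paths k

/-- The directed flag complex of `G`: the directed cliques of `G`. -/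
def dFl {V : Type u} (G : Digraph V) : PathComplex V where
  paths k := {p | Function.Injective p ∧ ∀ i j : Fin (k + 1), i < j → G.Adj (p i) (p j)}
  singleton_mem v := ⟨fun i j _ => Fin.ext (by omega),
    fun i j h => absurd h (by rw [Fin.lt_def]; omega)⟩
  tail_mem _ _ hp := ⟨fun _ _ h => Fin.succ_injective _ (hp.1 h),
    fun i j h => hp.2 _ _ (Fin.succ_lt_succ_iff.2 h)⟩
  init_mem _ _ hp := ⟨fun _ _ h => Fin.castSucc_injective _ (hp.1 h),
    fun i j h => hp.2 _ _ (Fin.castSucc_lt_castSucc_iff.2 h)⟩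

/-! ### The regular chain complex of a regular path complex -/

section Chains

variable (K : Type v) [Field K] {V : Type u}

/-- `Λ_k`: the free vector space on all elementary `k`-paths on `V`. -/
abbrev Lam (V : Type u) (k : ℕ) : Type (max u v) := ElemPath V k →₀ K

/-- The non-regular boundary map `v₀ … v_{k+1} ↦ ∑ᵢ (-1)ⁱ v₀ … v̂ᵢ … v_{k+1}`. -/
def bdNonreg (V : Type u) (k : ℕ) : Lam K V (k + 1) →ₗ[K] Lam K V k :=
  Finsupp.linearCombination K fun p : ElemPath V (k + 1) =>
    ∑ i : Fin (k + 2), (-1 : K) ^ (i : ℕ) • Finsupp.single (p.face i) (1 : K)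

open Classical in
/-- The projection of `Λ_k = R_k ⊕ I_k` onto the span `R_k` of the regular paths, along the span
`I_k` of the irregular ones. -/
def regProj (V : Type u) (k : ℕ) : Lam K V k →ₗ[K] Lam K V k :=
  Finsupp.linearCombination K fun p : ElemPath V k =>
    if p.IsRegular then Finsupp.single p (1 : K) else 0

/-- The regular boundary map: the usual boundary with the irregular summands dropped. -/
def bd (V : Type u) (k : ℕ) : Lam K V (k + 1) →ₗ[K] Lam K V k :=
  regProj K V k ∘ₗ bdNonreg K V k

/-- `C_k(P)`: the span of the `k`-paths of `P`. -/
def pathChains (P : PathComplex V) (k : ℕ) : Submodule K (Lam K V k) :=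
  Finsupp.supported K K (P.paths k)

/-- `Ω_k(P)`: the chains in `C_k(P)` whose regular boundary lies in `C_{k-1}(P)`. -/
def Omega (P : PathComplex V) : ∀ k : ℕ, Submodule K (Lam K V k)
  | 0 => pathChains K P 0
  | k + 1 => pathChains K P (k + 1) ⊓ (pathChains K P k).comap (bd K V k)

theorem bdNonreg_single (k : ℕ) (p : ElemPath V (k + 1)) :
    bdNonreg K V k (Finsupp.single p 1) =
      ∑ i : Fin (k + 2), (-1 : K) ^ (i : ℕ) • Finsupp.single (p.face i) (1 : K) := by
  simp [bdNonreg, Finsupp.linearCombination_single]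

open Classical in
theorem regProj_single (k : ℕ) (p : ElemPath V k) :
    regProj K V k (Finsupp.single p 1) =
      if p.IsRegular then Finsupp.single p (1 : K) else 0 := by
  simp [regProj, Finsupp.linearCombination_single]

theorem bdNonreg_bdNonreg (k : ℕ) : bdNonreg K V k ∘ₗ bdNonreg K V (k + 1) = 0 := by
  refine Finsupp.lhom_ext' fun p => LinearMap.ext_ring ?_
  simp only [LinearMap.comp_apply, Finsupp.lsingle_apply, bdNonreg_single, map_sum, map_smul,
    LinearMap.zero_apply, Finset.smul_sum, smul_smul]
  rw [← Finset.sum_product']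
  refine Finset.sum_involution
    (fun ij _ => (ij.1.succAbove ij.2, ij.2.predAbove ij.1)) ?_ ?_ ?_ ?_
  · rintro ⟨i, j⟩ -
    have hface : (p.face (i.succAbove j)).face (j.predAbove i) = (p.face i).face j := by
      funext l
      simp only [ElemPath.face, Fin.succAbove_succAbove_succAbove_predAbove]
    dsimp only
    rw [hface, ← pow_add, ← pow_add, Fin.neg_one_pow_succAbove_add_predAbove, neg_smul,
      add_neg_cancel]
  · rintro ⟨i, j⟩ - - h
    exact Fin.succAbove_ne i j (congrArg Prod.fst h)
  · simp
  · rintro ⟨i, j⟩ -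
    exact Prod.ext (Fin.succAbove_succAbove_predAbove i j) (Fin.predAbove_predAbove_succAbove i j)

theorem regProj_bdNonreg_of_irregular (k : ℕ) (p : ElemPath V (k + 1)) (hp : ¬ p.IsRegular) :
    regProj K V k (bdNonreg K V k (Finsupp.single p 1)) = 0 := by
  classical
  obtain ⟨j, hj⟩ : ∃ j : Fin (k + 1), p j.castSucc = p j.succ := by
    simpa [ElemPath.IsRegular] using hp
  rw [bdNonreg_single, map_sum]
  have hface : p.face j.castSucc = p.face j.succ := by
    funext l
    rcases lt_trichotomy l j with h | h | h
    · simp only [ElemPath.face]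
      rw [Fin.succAbove_of_castSucc_lt _ _ (Fin.castSucc_lt_castSucc_iff.2 h),
        Fin.succAbove_of_castSucc_lt _ _ (by rw [Fin.lt_def] at h ⊢; simp; omega)]
    · subst h
      simp only [ElemPath.face, Fin.succAbove_castSucc_self, Fin.succAbove_succ_self, hj]
    · simp only [ElemPath.face]
      rw [Fin.succAbove_of_le_castSucc _ _ (Fin.castSucc_le_castSucc_iff.2 h.le),
        Fin.succAbove_of_le_castSucc _ _ (by rw [Fin.lt_def] at h; rw [Fin.le_def]; simp; omega)]
  rw [Finset.sum_eq_add j.castSucc j.succ (by simp [Fin.ext_iff])]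
  · rw [hface, ← map_add, ← add_smul]
    simp [pow_succ]
  · rintro i - ⟨h1, h2⟩
    rw [map_smul, regProj_single, if_neg, smul_zero]
    intro hreg
    have h1' : (i : ℕ) ≠ j := fun h => h1 (Fin.ext h)
    have h2' : (i : ℕ) ≠ j + 1 := fun h => h2 (Fin.ext h)
    have hi := i.isLt
    have hjl := j.isLt
    rcases lt_or_gt_of_ne h1' with h | h
    · have e1 : i.succAbove (Fin.castSucc (⟨j - 1, by omega⟩ : Fin k)) = j.castSucc := by
        rw [Fin.succAbove_of_le_castSucc _ _ (by rw [Fin.le_def]; simp; omega)]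
        ext; simp; omega
      have e2 : i.succAbove (Fin.succ (⟨j - 1, by omega⟩ : Fin k)) = j.succ := by
        rw [Fin.succAbove_of_le_castSucc _ _ (by rw [Fin.le_def]; simp; omega)]
        ext; simp; omega
      refine hreg ⟨j - 1, by omega⟩ ?_
      simp only [ElemPath.face]
      rw [e1, e2, hj]
    · have e1 : i.succAbove (Fin.castSucc (⟨j, by omega⟩ : Fin k)) = j.castSucc := by
        rw [Fin.succAbove_of_castSucc_lt _ _ (by rw [Fin.lt_def]; simp; omega)]
        ext; simp
      have e2 : i.succAbove (Fin.succ (⟨j, by omega⟩ : Fin k)) = j.succ := by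
        rw [Fin.succAbove_of_castSucc_lt _ _ (by rw [Fin.lt_def]; simp; omega)]
        ext; simp
      refine hreg ⟨j, by omega⟩ ?_
      simp only [ElemPath.face]
      rw [e1, e2, hj]
  · simp
  · simp

theorem regProj_bdNonreg_regProj (k : ℕ) :
    regProj K V k ∘ₗ bdNonreg K V k ∘ₗ regProj K V (k + 1) = regProj K V k ∘ₗ bdNonreg K V k := by
  classical
  refine Finsupp.lhom_ext' fun p => LinearMap.ext_ring ?_
  simp only [LinearMap.comp_apply, Finsupp.lsingle_apply, regProj_single]
  split_ifs with h
  · rfl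
  · rw [regProj_bdNonreg_of_irregular K k p h, map_zero, map_zero]

theorem bd_bd (k : ℕ) : bd K V k ∘ₗ bd K V (k + 1) = 0 := by
  have h : bd K V k ∘ₗ bd K V (k + 1) =
      (regProj K V k ∘ₗ bdNonreg K V k ∘ₗ regProj K V (k + 1)) ∘ₗ bdNonreg K V (k + 1) := rfl
  rw [h, regProj_bdNonreg_regProj, LinearMap.comp_assoc, bdNonreg_bdNonreg, LinearMap.comp_zero]

theorem bd_mem_Omega (P : PathComplex V) (k : ℕ) {c : Lam K V (k + 1)}
    (hc : c ∈ Omega K P (k + 1)) : bd K V k c ∈ Omega K P k := by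
  cases k with
  | zero => exact hc.2
  | succ k =>
    refine ⟨hc.2, ?_⟩
    have h : bd K V k (bd K V (k + 1) c) = 0 := LinearMap.congr_fun (bd_bd K k) c
    change bd K V k (bd K V (k + 1) c) ∈ pathChains K P k
    rw [h]
    exact Submodule.zero_mem _

theorem pathChains_mono {P Q : PathComplex V} (h : ∀ k, P.paths k ⊆ Q.paths k) (k : ℕ) :
    pathChains K P k ≤ pathChains K Q k :=
  Finsupp.supported_mono (h k)

theorem Omega_mono {P Q : PathComplex V} (h : ∀ k, P.paths k ⊆ Q.paths k) (k : ℕ) :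
    Omega K P k ≤ Omega K Q k := by
  cases k with
  | zero => exact pathChains_mono K h 0
  | succ k => exact inf_le_inf (pathChains_mono K h _) (Submodule.comap_mono (pathChains_mono K h _))

end Chains

theorem dFl_mono {V : Type u} {G H : Digraph V} (h : G ≤ H) (k : ℕ) :
    (dFl G).paths k ⊆ (dFl H).paths k :=
  fun _ hp => ⟨hp.1, fun i j hij => h (hp.2 i j hij)⟩

/-! ### Maps of digraphs and homotopies -/

section Maps

variable {V W : Type u}

/-- `v ⇒ w`: either `v = w` or there is an edge `v → w`. -/
def AdjOrEq (G : Digraph V) (v w : V) : Prop := v = w ∨ G.Adj v w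

/-- Weak digraph maps. -/
def IsWeakMap (G : Digraph V) (H : Digraph W) (f : V → W) : Prop :=
  ∀ v w : V, G.Adj v w → f v = f w ∨ H.Adj (f v) (f w)

/-- Triangle-collapsing digraph maps. -/
def IsTriangleCollapsing (G : Digraph V) (H : Digraph W) (f : V → W) : Prop :=
  IsWeakMap G H f ∧ ∀ p ∈ (dFl G).paths 2, f (p 0) = f (p 2) →
    f (p 0) = f (p 1) ∧ f (p 1) = f (p 2)

/-- The triangle-collapsing digraph maps `G → H`. -/
abbrev TcMap (G : Digraph V) (H : Digraph W) : Type u :=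
  {f : V → W // IsTriangleCollapsing G H f}

/-- There is a one-step homotopy from `f` to `g` in the directed flag system. -/
def OneStep {G : Digraph V} {H : Digraph W} (f g : TcMap G H) : Prop :=
  (∀ x y : V, AdjOrEq G x y → AdjOrEq H (f.1 x) (g.1 y)) ∧
  (∀ x y : V, G.Adj x y → f.1 x = g.1 y →
    f.1 x = f.1 y ∧ f.1 y = g.1 x ∧ g.1 x = g.1 y)

/-- One-step homotopies relative to `A`. -/
def OneStepRel {G : Digraph V} {H : Digraph W} (A : Set V) (f g : TcMap G H) : Prop :=
  OneStep f g ∧ ∀ v ∈ A, f.1 v = g.1 v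

/-- `f` and `g` are homotopic relative to `A`: the equivalence relation generated by one-step
homotopies relative to `A`. -/
def HomotopicRel {G : Digraph V} {H : Digraph W} (A : Set V) (f g : TcMap G H) : Prop :=
  Relation.EqvGen (OneStepRel A) f g

end Maps

/-! ### Weighted digraphs and the shortest-path filtration -/

/-- A (simple) weighted digraph with vertex set `V`. -/
structure WDigraph (V : Type u) extends Digraph V where
  loopless : ∀ v : V, ¬ Adj v v
  weight : ∀ v w : V, Adj v w → ℝ
  weight_pos : ∀ (v w : V) (h : Adj v w), 0 < weight v w h

namespace WDigraph

variable {V W : Type u}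

/-- Paths in a weighted digraph: non-empty sequences of composable edges. -/
inductive Path (G : WDigraph V) : V → V → Type u
  | single {i j : V} (h : G.Adj i j) : Path G i j
  | cons {i j k : V} (h : G.Adj i j) (p : Path G j k) : Path G i k

/-- The length of a path is the sum of the weights of its edges. -/
def Path.length {G : WDigraph V} : ∀ {i j : V}, G.Path i j → ℝ
  | _, _, .single h => G.weight _ _ h
  | _, _, .cons h p => G.weight _ _ h + p.length

/-- The shortest-path filtration at time `t`, as a simple digraph. -/
def SP (G : WDigraph V) (t : ℝ) : Digraph V where
  Adj i j := i ≠ j ∧ ∃ p : G.Path i j, p.length ≤ t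

/-- The union `G ∪ SP(G)_t`. -/
def unionSP (G : WDigraph V) (t : ℝ) : Digraph V := G.toDigraph ⊔ G.SP t

theorem SP_mono (G : WDigraph V) {s t : ℝ} (h : s ≤ t) : G.SP s ≤ G.SP t :=
  fun _ _ hij => ⟨hij.1, hij.2.imp fun _ hp => hp.trans h⟩

theorem unionSP_mono (G : WDigraph V) {s t : ℝ} (h : s ≤ t) : G.unionSP s ≤ G.unionSP t :=
  fun _ _ hij => hij.imp id (fun h' => G.SP_mono h h')

/-- Path-collapsing: if `i ⇝ j ⇝ k` for distinct vertices `i, j, k` and `f i = f k`, then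
`f i = f j = f k`. (Without distinctness the identity of a digraph with a directed cycle would not
be path-collapsing.) -/
def IsPathCollapsing (G : WDigraph V) (f : V → W) : Prop :=
  ∀ i j k : V, i ≠ j → j ≠ k → i ≠ k → Nonempty (G.Path i j) → Nonempty (G.Path j k) →
    f i = f k → f i = f j ∧ f j = f k

/-- `δ`-shifting vertex maps; the filtration parameter ranges over `[0, ∞)`. -/
def IsShifting (G : WDigraph V) (H : WDigraph W) (δ : ℝ≥0) (f : V → W) : Prop :=
  ∀ t : ℝ≥0, IsWeakMap (G.SP t) (H.SP (t + δ)) f ∧ IsWeakMap (G.unionSP t) (H.unionSP (t + δ)) f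

/-- `V_fix(g, f)`. -/
def Vfix (g : W → V) (f : V → W) : Set V := {v | g (f v) = v}

/-- `G_diff(g, f)`: the digraph on `V(G)` of the edges of `G` which `g ∘ f` does not fix. -/
def Gdiff (G : WDigraph V) (g : W → V) (f : V → W) : Digraph V where
  Adj i j := G.Adj i j ∧ (g (f i), g (f j)) ≠ (i, j)

/-- `(g, f)` has grounded codistortion at most `δ` (for the directed flag system). -/
def GroundedCodistortionLE (G : WDigraph V) (g : W → V) (f : V → W) (δ : ℝ≥0) : Prop :=
  ∃ (hid : IsTriangleCollapsing (G.Gdiff g f) (G.SP (2 * δ)) id)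
    (hgf : IsTriangleCollapsing (G.Gdiff g f) (G.SP (2 * δ)) (g ∘ f)),
    HomotopicRel (Vfix g f) (⟨id, hid⟩ : TcMap (G.Gdiff g f) (G.SP (2 * δ))) ⟨g ∘ f, hgf⟩

/-- `f` and `g` form a `δ`-grounded interleaving (for the directed flag system). -/
structure IsGroundedInterleaving (G : WDigraph V) (H : WDigraph W) (δ : ℝ≥0)
    (f : V → W) (g : W → V) : Prop where
  pathCollapsing_left : G.IsPathCollapsing f
  pathCollapsing_right : H.IsPathCollapsing g
  shifting_left : IsShifting G H δ f
  shifting_right : IsShifting H G δ g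
  codistortion_left : GroundedCodistortionLE G g f δ
  codistortion_right : GroundedCodistortionLE H f g δ

/-! ### Grounded persistent directed flag homology -/

section Grounded

variable (K : Type v) [Field K] (G : WDigraph V)

/-- The chain groups of the grounded complex at time `t`: `Ω_k(dFl(G ∪ SP(G)_t))` for `k ≤ 1` and
`Ω_k(dFl(SP(G)_t))` for `k ≥ 2`. -/
def groundedChains (t : ℝ≥0) : ∀ k : ℕ, Submodule K (Lam K V k)
  | 0 => Omega K (dFl (G.unionSP t)) 0
  | 1 => Omega K (dFl (G.unionSP t)) 1
  | k + 2 => Omega K (dFl (G.SP t)) (k + 2)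

theorem bd_mem_groundedChains (t : ℝ≥0) (k : ℕ) :
    ∀ c ∈ groundedChains K G t (k + 1), bd K V k c ∈ groundedChains K G t k := by
  intro c hc
  match k, c, hc with
  | 0, c, hc => exact bd_mem_Omega K _ 0 hc
  | 1, c, hc =>
    exact Omega_mono K (dFl_mono (le_sup_right : G.SP t ≤ G.unionSP t)) 1
      (bd_mem_Omega K _ 1 hc)
  | k + 2, c, hc => exact bd_mem_Omega K _ (k + 2) hc

theorem groundedChains_mono {s t : ℝ≥0} (h : s ≤ t) (k : ℕ) :
    groundedChains K G s k ≤ groundedChains K G t k := by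
  have h' : (s : ℝ) ≤ t := h
  match k with
  | 0 => exact Omega_mono K (dFl_mono (G.unionSP_mono h')) 0
  | 1 => exact Omega_mono K (dFl_mono (G.unionSP_mono h')) 1
  | k + 2 => exact Omega_mono K (dFl_mono (G.SP_mono h')) (k + 2)

/-- The boundary maps of the grounded complex. -/
def groundedBd (t : ℝ≥0) (k : ℕ) :
    groundedChains K G t (k + 1) →ₗ[K] groundedChains K G t k :=
  (bd K V k).restrict (bd_mem_groundedChains K G t k)

theorem groundedBd_comp (t : ℝ≥0) (k : ℕ) :
    groundedBd K G t k ∘ₗ groundedBd K G t (k + 1) = 0 :=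
  LinearMap.ext fun c => Subtype.ext (LinearMap.congr_fun (bd_bd K k) c.1)

/-- The grounded chain complex of `G` at time `t`. -/
def groundedComplex (t : ℝ≥0) : ChainComplex (ModuleCat.{max u v} K) ℕ :=
  ChainComplex.of (fun k => ModuleCat.of K (groundedChains K G t k))
    (fun k => ModuleCat.ofHom (groundedBd K G t k))
    (fun k => by rw [← ModuleCat.ofHom_comp, groundedBd_comp, ModuleCat.ofHom_zero])

/-- The inclusion of grounded complexes for `s ≤ t`. -/
def groundedInclusion {s t : ℝ≥0} (h : s ≤ t) : groundedComplex K G s ⟶ groundedComplex K G t :=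
  ChainComplex.ofHom
    (fun k => ModuleCat.ofHom (Submodule.inclusion (groundedChains_mono K G h k)))
    (fun k => by
      simp only [groundedComplex, ChainComplex.of_d]
      rfl)

/-- The persistent grounded chain complex of `G`. -/
def persistentGroundedComplex : ℝ≥0 ⥤ ChainComplex (ModuleCat.{max u v} K) ℕ where
  obj t := groundedComplex K G t
  map h := groundedInclusion K G (leOfHom h)
  map_id _ := by
    ext k : 1
    rfl
  map_comp _ _ := by
    ext k : 1
    rfl

/-- Grounded persistent directed flag homology of `G`, with coefficients in `K`. -/
def groundedHomology : ℝ≥0 ⥤ ModuleCat.{max u v} K :=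
  persistentGroundedComplex K G ⋙ HomologicalComplex.homologyFunctor _ _ 1

end Grounded

end WDigraph

/-! ### The interleaving distance -/

section Interleaving

variable {C : Type*} [Category C]

/-- The `δ`-shift `M(· + δ)` of a persistent object. -/
def shift (M : ℝ≥0 ⥤ C) (δ : ℝ≥0) : ℝ≥0 ⥤ C where
  obj t := M.obj (t + δ)
  map h := M.map (homOfLE (add_le_add_left (leOfHom h) δ))
  map_id t := M.map_id (t + δ)
  map_comp _ _ := M.map_comp _ _

/-- `M` and `N` are `δ`-interleaved. -/
def IsInterleaved (M N : ℝ≥0 ⥤ C) (δ : ℝ≥0) : Prop :=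
  ∃ (φ : M ⟶ shift N δ) (ψ : N ⟶ shift M δ),
    (∀ t : ℝ≥0, φ.app t ≫ ψ.app (t + δ) =
      M.map (homOfLE (le_self_add.trans le_self_add : t ≤ t + δ + δ))) ∧
    (∀ t : ℝ≥0, ψ.app t ≫ φ.app (t + δ) =
      N.map (homOfLE (le_self_add.trans le_self_add : t ≤ t + δ + δ)))

/-- The interleaving distance, with values in `[0, ∞]`. -/
def interleavingDist (M N : ℝ≥0 ⥤ C) : ℝ≥0∞ :=
  ⨅ (δ : ℝ≥0) (_ : IsInterleaved M N δ), (δ : ℝ≥0∞)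

end Interleaving

end GroundedFlag

end

/-! Vertex maps `f` and `g` act on chains, and `id` and `g ∘ f` have to be compared on cycles `c` of
`C₁(G ∪ SP(G)_t)`. One-step homotopies add up to a linear map `h : Λ₀ → Λ₁` such that
`g f c - c - h ∂c` is a boundary of triangles of `SP(G)_{2δ}` whenever `c` is an edge of `G`: on the
edges of `G_diff` because of the homotopy, on the others because all three terms vanish. An edge of
`SP(G)_t` is the sum of the edges of a path in `G` up to boundaries of triangles of `SP(G)_t`, and
`g ∘ f` maps these triangles to triangles of `SP(G)_{t+2δ}`. So `g f c - c` is a boundary as soon as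
`∂c = 0`. -/

noncomputable section

namespace GroundedFlag

section Push

variable (K : Type v) [Field K] {U V W : Type*} {k : ℕ}

/-- The chain represented by an elementary path: the path itself if it is regular, and zero
otherwise. With this convention vertex maps and boundaries act on all paths alike. -/
def regSingle (p : ElemPath V k) : Lam K V k :=
  regProj K V k (Finsupp.single p 1)

theorem regSingle_of_isRegular {p : ElemPath V k} (hp : p.IsRegular) :
    regSingle K p = Finsupp.single p 1 := by
  rw [regSingle, regProj_single, if_pos hp]

theorem regSingle_of_not_isRegular {p : ElemPath V k} (hp : ¬ p.IsRegular) :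
    regSingle K p = 0 := by
  rw [regSingle, regProj_single, if_neg hp]

theorem bd_single (p : ElemPath V (k + 1)) :
    bd K V k (Finsupp.single p 1) =
      ∑ i : Fin (k + 2), (-1 : K) ^ (i : ℕ) • regSingle K (p.face i) := by
  simp only [bd, LinearMap.comp_apply, bdNonreg_single, map_sum, map_smul, regSingle]

theorem bd_regSingle (p : ElemPath V (k + 1)) :
    bd K V k (regSingle K p) = ∑ i : Fin (k + 2), (-1 : K) ^ (i : ℕ) • regSingle K (p.face i) := by
  rw [← bd_single]
  exact LinearMap.congr_fun (regProj_bdNonreg_regProj K k) _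

theorem bd_bd_apply (c : Lam K V (k + 2)) : bd K V k (bd K V (k + 1) c) = 0 :=
  LinearMap.congr_fun (bd_bd K k) c

/-- The map `Λ_k(V) → Λ_k(W)` induced by a vertex map, with irregular images dropped. -/
def push (f : V → W) (k : ℕ) : Lam K V k →ₗ[K] Lam K W k :=
  Finsupp.linearCombination K fun p : ElemPath V k => regSingle K (f ∘ p : ElemPath W k)

theorem push_single (f : V → W) (p : ElemPath V k) :
    push K f k (Finsupp.single p 1) = regSingle K (f ∘ p : ElemPath W k) := by
  rw [push, Finsupp.linearCombination_single, one_smul]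

theorem push_regSingle (f : V → W) (p : ElemPath V k) :
    push K f k (regSingle K p) = regSingle K (f ∘ p : ElemPath W k) := by
  by_cases hp : p.IsRegular
  · rw [regSingle_of_isRegular K hp, push_single]
  · have hfp : ¬ ElemPath.IsRegular (f ∘ p : ElemPath W k) :=
      fun h => hp fun i hi => h i (congrArg f hi)
    rw [regSingle_of_not_isRegular K hp, regSingle_of_not_isRegular K hfp, map_zero]

theorem push_push (g : V → W) (f : U → V) (c : Lam K U k) :
    push K g k (push K f k c) = push K (g ∘ f) k c := by
  suffices h : push K g k ∘ₗ push K f k = push K (g ∘ f) k from LinearMap.congr_fun h c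
  refine Finsupp.lhom_ext' fun p => LinearMap.ext_ring ?_
  simp only [LinearMap.comp_apply, Finsupp.lsingle_apply, push_single, push_regSingle]
  rfl

theorem bd_push (f : V → W) (c : Lam K V (k + 1)) :
    bd K W k (push K f (k + 1) c) = push K f k (bd K V k c) := by
  suffices h : bd K W k ∘ₗ push K f (k + 1) = push K f k ∘ₗ bd K V k from LinearMap.congr_fun h c
  refine Finsupp.lhom_ext' fun p => LinearMap.ext_ring ?_
  simp only [LinearMap.comp_apply, Finsupp.lsingle_apply, push_single, bd_regSingle, bd_single,
    map_sum, map_smul, push_regSingle]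
  rfl

end Push

section FlagChains

variable (K : Type v) [Field K] {V : Type u} {G : Digraph V} {k : ℕ}

theorem regSingle_mem_pathChains {P : PathComplex V} {p : ElemPath V k}
    (hp : p.IsRegular → p ∈ P.paths k) : regSingle K p ∈ pathChains K P k := by
  by_cases h : p.IsRegular
  · rw [regSingle_of_isRegular K h]
    exact Finsupp.single_mem_supported K 1 (hp h)
  · rw [regSingle_of_not_isRegular K h]
    exact Submodule.zero_mem _

theorem isRegular_of_mem_dFl {p : ElemPath V k} (hp : p ∈ (dFl G).paths k) : p.IsRegular :=
  fun _ => hp.1.ne Fin.castSucc_lt_succ.ne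

theorem mem_dFl_of_lt {p : ElemPath V k} (hp : ∀ i j, i < j → p i ≠ p j ∧ G.Adj (p i) (p j)) :
    p ∈ (dFl G).paths k :=
  ⟨Function.Injective.of_lt_imp_ne fun i j hij => (hp i j hij).1, fun i j hij => (hp i j hij).2⟩

theorem face_mem_dFl {p : ElemPath V (k + 1)} (hp : p ∈ (dFl G).paths (k + 1)) (i : Fin (k + 2)) :
    p.face i ∈ (dFl G).paths k :=
  ⟨hp.1.comp Fin.succAbove_right_injective, fun _ _ h => hp.2 _ _ (Fin.strictMono_succAbove i h)⟩

theorem pathChains_dFl_le_iff {S : Submodule K (Lam K V k)} :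
    pathChains K (dFl G) k ≤ S ↔ ∀ p ∈ (dFl G).paths k, regSingle K p ∈ S := by
  rw [pathChains, Finsupp.supported_eq_span_single, Submodule.span_le, Set.image_subset_iff]
  refine forall₂_congr fun p hp => ?_
  rw [regSingle_of_isRegular K (isRegular_of_mem_dFl hp)]
  rfl

theorem Omega_dFl (G : Digraph V) (k : ℕ) : Omega K (dFl G) k = pathChains K (dFl G) k := by
  cases k with
  | zero => rfl
  | succ k =>
    refine inf_eq_left.2 ((pathChains_dFl_le_iff K).2 fun p hp => ?_)
    rw [Submodule.mem_comap, bd_regSingle]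
    exact Submodule.sum_smul_mem _ _ fun i _ =>
      regSingle_mem_pathChains K fun _ => face_mem_dFl hp i

theorem push_id_of_mem_pathChains {c : Lam K V k} (hc : c ∈ pathChains K (dFl G) k) :
    push K id k c = c := by
  have hle : pathChains K (dFl G) k ≤ LinearMap.eqLocus (push K id k) LinearMap.id :=
    (pathChains_dFl_le_iff K).2 fun p _ => push_regSingle K id p
  exact hle hc

variable {W : Type u} {H : Digraph W} {f : V → W}

theorem push_mem_pathChains (hf : IsWeakMap G H f)
    (hinj : ∀ p ∈ (dFl G).paths k, ElemPath.IsRegular (f ∘ p : ElemPath W k) →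
      Function.Injective (f ∘ p))
    {c : Lam K V k} (hc : c ∈ pathChains K (dFl G) k) : push K f k c ∈ pathChains K (dFl H) k := by
  have hle : pathChains K (dFl G) k ≤ (pathChains K (dFl H) k).comap (push K f k) := by
    refine (pathChains_dFl_le_iff K).2 fun p hp => ?_
    rw [Submodule.mem_comap, push_regSingle]
    refine regSingle_mem_pathChains K fun hreg => mem_dFl_of_lt fun i j hij => ?_
    have hne : f (p i) ≠ f (p j) := (hinj p hp hreg).ne hij.ne
    exact ⟨hne, (hf _ _ (hp.2 i j hij)).resolve_left hne⟩
  exact hle hc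

end FlagChains

section Edges

variable (K : Type v) [Field K] {V W : Type*}

/-- The edge `x y` as a `1`-chain, which vanishes if `x = y`; it need not belong to any digraph. -/
def edge (x y : V) : Lam K V 1 := regSingle K ![x, y]

theorem edge_self (x : V) : edge K x x = 0 :=
  regSingle_of_not_isRegular K fun h => h 0 rfl

theorem push_edge (f : V → W) (x y : V) : push K f 1 (edge K x y) = edge K (f x) (f y) := by
  rw [edge, push_regSingle, edge]
  congr 1
  ext i
  fin_cases i <;> rfl

theorem bd_edge (x y : V) :
    bd K V 0 (edge K x y) = Finsupp.single ![y] 1 - Finsupp.single ![x] 1 := by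
  have h0 : ElemPath.face (![x, y] : ElemPath V 1) 0 = ![y] := by
    ext i; fin_cases i; rfl
  have h1 : ElemPath.face (![x, y] : ElemPath V 1) 1 = ![x] := by
    ext i; fin_cases i; rfl
  have hvertex (v : V) : regSingle K (![v] : ElemPath V 0) = Finsupp.single ![v] 1 :=
    regSingle_of_isRegular K fun i => i.elim0
  rw [edge, bd_regSingle, Fin.sum_univ_two, h0, h1, hvertex, hvertex]
  simp [sub_eq_add_neg]

theorem bd_triangle (x y z : V) :
    bd K V 1 (regSingle K ![x, y, z]) = edge K y z - edge K x z + edge K x y := by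
  have h0 : ElemPath.face (![x, y, z] : ElemPath V 2) 0 = ![y, z] := by
    ext i; fin_cases i <;> rfl
  have h1 : ElemPath.face (![x, y, z] : ElemPath V 2) 1 = ![x, z] := by
    ext i; fin_cases i <;> rfl
  have h2 : ElemPath.face (![x, y, z] : ElemPath V 2) 2 = ![x, y] := by
    ext i; fin_cases i <;> rfl
  rw [bd_regSingle, Fin.sum_univ_three, h0, h1, h2]
  simp [edge, sub_eq_add_neg]

end Edges

section Homotopy

variable (K : Type v) [Field K] {V W : Type u} {G : Digraph V} {H : Digraph W}

theorem pathChains_dFl_one_le {S : Submodule K (Lam K V 1)}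
    (hS : ∀ x y, G.Adj x y → edge K x y ∈ S) : pathChains K (dFl G) 1 ≤ S := by
  refine (pathChains_dFl_le_iff K).2 fun p hp => ?_
  have hpair : p = ![p 0, p 1] := by
    ext i; fin_cases i <;> rfl
  rw [hpair]
  exact hS _ _ (hp.2 0 1 Fin.zero_lt_one)

theorem edge_mem_pathChains {x y : V} (h : G.Adj x y) : edge K x y ∈ pathChains K (dFl G) 1 := by
  refine regSingle_mem_pathChains K fun hreg => mem_dFl_of_lt fun i j hij => ?_
  have hxy : x ≠ y := hreg 0
  fin_cases i <;> fin_cases j <;> simp_all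

/-- The boundaries of the directed `3`-cliques of `G`, as a space of `1`-chains. -/
def triangleBoundaries (G : Digraph V) : Submodule K (Lam K V 1) :=
  (pathChains K (dFl G) 2).map (bd K V 1)

theorem triangleBoundaries_mono {G G' : Digraph V} (h : G ≤ G') :
    triangleBoundaries K G ≤ triangleBoundaries K G' :=
  Submodule.map_mono (pathChains_mono K (dFl_mono h) 2)

theorem edge_cycle_mem_triangleBoundaries {x y z : V} (hxy : AdjOrEq G x y) (hyz : AdjOrEq G y z)
    (hxz : AdjOrEq G x z) (hcollapse : x = z → x = y) :
    edge K y z - edge K x z + edge K x y ∈ triangleBoundaries K G := by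
  rw [← bd_triangle]
  refine Submodule.mem_map_of_mem
    (regSingle_mem_pathChains K fun hreg => mem_dFl_of_lt fun i j hij => ?_)
  have hxy' : x ≠ y := hreg 0
  have hyz' : y ≠ z := hreg 1
  have hxz' : x ≠ z := hxy' ∘ hcollapse
  have := hxy.resolve_left hxy'
  have := hyz.resolve_left hyz'
  have := hxz.resolve_left hxz'
  fin_cases i <;> fin_cases j <;> simp_all

/-- The failure `g - f - h ∂` of `h` to be a chain homotopy from `f` to `g` on `1`-chains, if the
term `∂ h₁` is disregarded. Homotopies are only needed up to boundaries, so no `h₁` is recorded. -/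
def homotopyDefect (f g : V → W) (h : Lam K V 0 →ₗ[K] Lam K W 1) : Lam K V 1 →ₗ[K] Lam K W 1 :=
  push K g 1 - push K f 1 - h ∘ₗ bd K V 0

theorem homotopyDefect_edge (f g : V → W) (h : Lam K V 0 →ₗ[K] Lam K W 1) (x y : V) :
    homotopyDefect K f g h (edge K x y) = edge K (g x) (g y) - edge K (f x) (f y) -
      (h (Finsupp.single ![y] 1) - h (Finsupp.single ![x] 1)) := by
  simp only [homotopyDefect, LinearMap.sub_apply, LinearMap.comp_apply, push_edge, bd_edge, map_sub]

theorem homotopyDefect_of_bd_eq_zero (f g : V → W) (h : Lam K V 0 →ₗ[K] Lam K W 1) {c : Lam K V 1}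
    (hc : bd K V 0 c = 0) : homotopyDefect K f g h c = push K g 1 c - push K f 1 c := by
  simp only [homotopyDefect, LinearMap.sub_apply, LinearMap.comp_apply, hc, map_zero, sub_zero]

theorem homotopyDefect_bd (f g : V → W) (h : Lam K V 0 →ₗ[K] Lam K W 1) (c : Lam K V 2) :
    homotopyDefect K f g h (bd K V 1 c) = bd K W 1 (push K g 2 c - push K f 2 c) := by
  rw [homotopyDefect_of_bd_eq_zero K f g h (bd_bd_apply K c), map_sub, bd_push, bd_push]

theorem homotopyDefect_self (f : V → W) : homotopyDefect K f f 0 = 0 := by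
  refine LinearMap.ext fun c => ?_
  simp only [homotopyDefect, LinearMap.sub_apply, LinearMap.comp_apply, LinearMap.zero_apply,
    sub_self]

theorem homotopyDefect_symm (f g : V → W) (h : Lam K V 0 →ₗ[K] Lam K W 1) :
    homotopyDefect K g f (-h) = -homotopyDefect K f g h := by
  simp only [homotopyDefect, LinearMap.neg_comp]
  abel

theorem homotopyDefect_add (f f' f'' : V → W) (h h' : Lam K V 0 →ₗ[K] Lam K W 1) :
    homotopyDefect K f f'' (h + h') = homotopyDefect K f f' h + homotopyDefect K f' f'' h' := by
  simp only [homotopyDefect, LinearMap.add_comp]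
  abel

variable {A : Set V}

/-- The square with corners `f x, f y, g x, g y` is cut along its diagonal from `f x` to `g y`. -/
theorem OneStep.prism_mem_triangleBoundaries {f g : TcMap G H} (hfg : OneStep f g) {x y : V}
    (hxy : G.Adj x y) :
    edge K (g.1 x) (g.1 y) - edge K (f.1 x) (f.1 y) -
      (edge K (f.1 y) (g.1 y) - edge K (f.1 x) (g.1 x)) ∈ triangleBoundaries K H := by
  obtain ⟨hadj, hcollapse⟩ := hfg
  have hx : AdjOrEq H (f.1 x) (g.1 x) := hadj x x (.inl rfl)
  have hy : AdjOrEq H (f.1 y) (g.1 y) := hadj y y (.inl rfl)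
  have hdiag : AdjOrEq H (f.1 x) (g.1 y) := hadj x y (.inr hxy)
  have hupper := edge_cycle_mem_triangleBoundaries K hx (g.2.1 x y hxy) hdiag fun h =>
    (hcollapse x y hxy h).1.trans (hcollapse x y hxy h).2.1
  have hlower := edge_cycle_mem_triangleBoundaries K (f.2.1 x y hxy) hy hdiag fun h =>
    (hcollapse x y hxy h).1
  convert sub_mem hupper hlower using 1
  abel

theorem OneStepRel.exists_homotopyDefect_mem {f g : TcMap G H} (hfg : OneStepRel A f g) :
    ∃ h : Lam K V 0 →ₗ[K] Lam K W 1, (∀ v ∈ A, h (Finsupp.single ![v] 1) = 0) ∧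
      pathChains K (dFl G) 1 ≤ (triangleBoundaries K H).comap (homotopyDefect K f.1 g.1 h) := by
  let h : Lam K V 0 →ₗ[K] Lam K W 1 :=
    Finsupp.linearCombination K fun p => edge K (f.1 (p 0)) (g.1 (p 0))
  have hvertex (v : V) : h (Finsupp.single ![v] 1) = edge K (f.1 v) (g.1 v) := by
    simp [h, Finsupp.linearCombination_single]
  refine ⟨h, fun v hv => ?_, pathChains_dFl_one_le K fun x y hxy => ?_⟩
  · rw [hvertex, hfg.2 v hv, edge_self]
  · rw [Submodule.mem_comap, homotopyDefect_edge, hvertex, hvertex]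
    exact hfg.1.prism_mem_triangleBoundaries K hxy

theorem HomotopicRel.exists_homotopyDefect_mem {f g : TcMap G H} (hfg : HomotopicRel A f g) :
    ∃ h : Lam K V 0 →ₗ[K] Lam K W 1, (∀ v ∈ A, h (Finsupp.single ![v] 1) = 0) ∧
      pathChains K (dFl G) 1 ≤ (triangleBoundaries K H).comap (homotopyDefect K f.1 g.1 h) := by
  induction hfg with
  | rel f g hfg => exact hfg.exists_homotopyDefect_mem K
  | refl f =>
    refine ⟨0, fun _ _ => rfl, fun c _ => ?_⟩
    rw [Submodule.mem_comap, homotopyDefect_self]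
    exact Submodule.zero_mem _
  | symm f g _ ih =>
    obtain ⟨h, hA, hmem⟩ := ih
    refine ⟨-h, fun v hv => by rw [LinearMap.neg_apply, hA v hv, neg_zero], fun c hc => ?_⟩
    rw [Submodule.mem_comap, homotopyDefect_symm]
    exact neg_mem (hmem hc)
  | trans f f' f'' _ _ ih ih' =>
    obtain ⟨h, hA, hmem⟩ := ih
    obtain ⟨h', hA', hmem'⟩ := ih'
    refine ⟨h + h', fun v hv => by rw [LinearMap.add_apply, hA v hv, hA' v hv, add_zero],
      fun c hc => ?_⟩
    rw [Submodule.mem_comap, homotopyDefect_add K f.1 f'.1 f''.1]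
    exact add_mem (hmem hc) (hmem' hc)

end Homotopy

section Homology

open HomologicalComplex

variable {R ι : Type*} [Ring R] {c : ComplexShape ι} {C D : HomologicalComplex (ModuleCat R) c}

theorem homologyMap_eq_zero_of_forall_cycle (φ : C ⟶ D) (i j k : ι)
    (hφ : ∀ z : C.X j, C.d j k z = 0 → ∃ w : D.X i, D.d i j w = φ.f j z) :
    homologyMap φ j = 0 := by
  rw [← cancel_epi (C.homologyπ j), homologyπ_naturality, Limits.comp_zero]
  ext z
  have hz : C.d j k (C.iCycles j z) = 0 := by
    rw [← ModuleCat.comp_apply, iCycles_d]; rfl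
  obtain ⟨w, hw⟩ := hφ _ hz
  have hcycle : D.toCycles i j w = cyclesMap φ j z := by
    apply (ModuleCat.mono_iff_injective (D.iCycles j)).1 inferInstance
    rw [← ModuleCat.comp_apply, ← ModuleCat.comp_apply, toCycles_i, cyclesMap_i, hw]; rfl
  rw [ModuleCat.comp_apply, ← hcycle, ← ModuleCat.comp_apply, toCycles_comp_homologyπ]
  rfl

theorem homologyMap_eq_of_forall_cycle (φ ψ : C ⟶ D) (i j k : ι)
    (h : ∀ z : C.X j, C.d j k z = 0 → ∃ w : D.X i, D.d i j w = φ.f j z - ψ.f j z) :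
    homologyMap φ j = homologyMap ψ j := by
  rw [← sub_eq_zero, ← homologyMap_sub]
  exact homologyMap_eq_zero_of_forall_cycle (φ - ψ) i j k h

end Homology

namespace WDigraph

section Paths

variable {V W : Type u} {G : WDigraph V}

theorem Path.length_pos {i j : V} (p : G.Path i j) : 0 < p.length := by
  induction p with
  | single h => exact G.weight_pos _ _ h
  | cons h p ih => exact add_pos (G.weight_pos _ _ h) ih

theorem IsPathCollapsing.injective_of_isRegular {f : V → W} (hf : G.IsPathCollapsing f) {t : ℝ}
    {k : ℕ} {p : ElemPath V k} (hp : p ∈ (dFl (G.SP t)).paths k)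
    (hreg : ElemPath.IsRegular (f ∘ p : ElemPath W k)) : Function.Injective (f ∘ p) := by
  refine Function.Injective.of_lt_imp_ne fun i j hij heq => ?_
  obtain ⟨i, rfl⟩ := Fin.exists_castSucc_eq.2 (Fin.ne_last_of_lt hij)
  rcases (Fin.castSucc_lt_iff_succ_le.1 hij).eq_or_lt with rfl | hlt
  · exact hreg i heq
  · have hmid : i.castSucc < i.succ := Fin.castSucc_lt_succ
    exact hreg i (hf _ _ _ (hp.1.ne hmid.ne) (hp.1.ne hlt.ne) (hp.1.ne hij.ne)
      (hp.2 _ _ hmid).2.nonempty (hp.2 _ _ hlt).2.nonempty heq).1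

variable (K : Type v) [Field K]

theorem edge_mem_of_path {t : ℝ} {i j : V} (p : G.Path i j) (hp : p.length ≤ t) (hij : i ≠ j) :
    edge K i j ∈ pathChains K (dFl G.toDigraph) 1 ⊔ triangleBoundaries K (G.SP t) := by
  induction p with
  | single h => exact Submodule.mem_sup_left (edge_mem_pathChains K h)
  | @cons i k j h p ih =>
    have hik_mem := edge_mem_pathChains K h
    rcases eq_or_ne k j with rfl | hkj
    · exact Submodule.mem_sup_left hik_mem
    have hlength : G.weight _ _ h + p.length ≤ t := hp
    have hik_length : (Path.single h : G.Path i k).length ≤ t :=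
      (le_add_of_nonneg_right p.length_pos.le).trans hlength
    have hkj_length : p.length ≤ t :=
      (le_add_of_nonneg_left (G.weight_pos _ _ h).le).trans hlength
    have hik : i ≠ k := fun e => G.loopless k (e ▸ h)
    have htriangle := edge_cycle_mem_triangleBoundaries K (G := G.SP t)
      (.inr ⟨hik, .single h, hik_length⟩) (.inr ⟨hkj, p, hkj_length⟩) (.inr ⟨hij, .cons h p, hp⟩)
      fun e => absurd e hij
    convert sub_mem (add_mem (Submodule.mem_sup_left hik_mem) (ih hkj_length hkj))
      (Submodule.mem_sup_right htriangle) using 1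
    abel

theorem pathChains_unionSP_le (G : WDigraph V) (t : ℝ) :
    pathChains K (dFl (G.unionSP t)) 1 ≤
      pathChains K (dFl G.toDigraph) 1 ⊔ triangleBoundaries K (G.SP t) := by
  refine pathChains_dFl_one_le K fun x y hxy => ?_
  rcases hxy with hxy | ⟨hne, p, hp⟩
  · exact Submodule.mem_sup_left (edge_mem_pathChains K hxy)
  · exact edge_mem_of_path K p hp hne

end Paths

section Codistortion

variable (K : Type v) [Field K] {V W : Type u} {G : WDigraph V} {δ : ℝ≥0}

theorem GroundedCodistortionLE.exists_homotopyDefect_mem {f : V → W} {g : W → V}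
    (hcod : GroundedCodistortionLE G g f δ) :
    ∃ h : Lam K V 0 →ₗ[K] Lam K V 1, pathChains K (dFl G.toDigraph) 1 ≤
      (triangleBoundaries K (G.SP (2 * δ))).comap (homotopyDefect K id (g ∘ f) h) := by
  obtain ⟨_, _, hom⟩ := hcod
  obtain ⟨h, hfix, hdiff⟩ := hom.exists_homotopyDefect_mem K
  refine ⟨h, pathChains_dFl_one_le K fun x y hxy => ?_⟩
  by_cases hxy_fix : (g (f x), g (f y)) = (x, y)
  · obtain ⟨hx, hy⟩ := Prod.mk.inj hxy_fix
    simp [homotopyDefect_edge, hx, hy, hfix x hx, hfix y hy]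
  · exact hdiff (edge_mem_pathChains K ⟨hxy, hxy_fix⟩)

theorem push_sub_mem_triangleBoundaries {e : V → V} {h : Lam K V 0 →ₗ[K] Lam K V 1} {s t : ℝ}
    (hst : s ≤ t)
    (hG : pathChains K (dFl G.toDigraph) 1 ≤
      (triangleBoundaries K (G.SP t)).comap (homotopyDefect K id e h))
    (he : ∀ b ∈ pathChains K (dFl (G.SP s)) 2, push K e 2 b ∈ pathChains K (dFl (G.SP t)) 2)
    {c : Lam K V 1} (hc : c ∈ pathChains K (dFl (G.unionSP s)) 1) (hz : bd K V 0 c = 0) :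
    push K e 1 c - c ∈ triangleBoundaries K (G.SP t) := by
  have hSP : triangleBoundaries K (G.SP s) ≤
      (triangleBoundaries K (G.SP t)).comap (homotopyDefect K id e h) := by
    rintro _ ⟨b, hb, rfl⟩
    rw [Submodule.mem_comap, homotopyDefect_bd, push_id_of_mem_pathChains K hb]
    exact Submodule.mem_map_of_mem
      (sub_mem (he b hb) (pathChains_mono K (dFl_mono (G.SP_mono hst)) 2 hb))
  have hdefect := sup_le hG hSP (pathChains_unionSP_le K G s hc)
  rwa [Submodule.mem_comap, homotopyDefect_of_bd_eq_zero K _ _ _ hz,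
    push_id_of_mem_pathChains K hc] at hdefect

end Codistortion

section Grounded

variable (K : Type v) [Field K] {V W : Type u} {G : WDigraph V} {H : WDigraph W} {δ : ℝ≥0}

theorem push_mem_groundedChains {f : V → W} (hcol : G.IsPathCollapsing f)
    (hshift : IsShifting G H δ f) (t : ℝ≥0) (k : ℕ) :
    ∀ c ∈ groundedChains K G t k, push K f k c ∈ groundedChains K H (t + δ) k := by
  intro c hc
  match k, c, hc with
  | 0, c, hc =>
    simp only [groundedChains, Omega_dFl, NNReal.coe_add] at hc ⊢
    exact push_mem_pathChains K (hshift t).2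
      (fun _ _ _ i j _ => Subsingleton.elim (α := Fin 1) i j) hc
  | 1, c, hc =>
    simp only [groundedChains, Omega_dFl, NNReal.coe_add] at hc ⊢
    refine push_mem_pathChains K (hshift t).2 (fun p _ hreg => ?_) hc
    refine Function.Injective.of_lt_imp_ne fun i j hij => ?_
    fin_cases i <;> fin_cases j <;> first | exact hreg 0 | exact absurd hij (by decide)
  | k + 2, c, hc =>
    simp only [groundedChains, Omega_dFl, NNReal.coe_add] at hc ⊢
    exact push_mem_pathChains K (hshift t).1 (fun _ => hcol.injective_of_isRegular) hc

theorem groundedComplex_d (t : ℝ≥0) (k : ℕ) :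
    (groundedComplex K G t).d (k + 1) k = ModuleCat.ofHom (groundedBd K G t k) := by
  simp only [groundedComplex, ChainComplex.of_d]

/-- The chain map from parameter `t` to parameter `t + δ` which a path-collapsing `δ`-shifting
vertex map induces on grounded complexes. -/
def groundedPush {f : V → W} (hcol : G.IsPathCollapsing f) (hshift : IsShifting G H δ f)
    (t : ℝ≥0) : groundedComplex K G t ⟶ groundedComplex K H (t + δ) :=
  ChainComplex.ofHom
    (fun k => ModuleCat.ofHom ((push K f k).restrict (push_mem_groundedChains K hcol hshift t k)))
    (fun k => by
      simp only [groundedComplex, ChainComplex.of_d]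
      rw [← ModuleCat.ofHom_comp, ← ModuleCat.ofHom_comp]
      exact congrArg ModuleCat.ofHom (LinearMap.ext fun c => Subtype.ext (bd_push K f c.1)))

/-- The morphism of degree `δ` which a path-collapsing `δ`-shifting vertex map induces on grounded
persistent homology; one half of the interleaving. -/
def groundedHomologyPush {f : V → W} (hcol : G.IsPathCollapsing f) (hshift : IsShifting G H δ f) :
    groundedHomology K G ⟶ shift (groundedHomology K H) δ where
  app t := HomologicalComplex.homologyMap (groundedPush K hcol hshift t) 1
  naturality s t hst := by
    have hchain : groundedInclusion K G (leOfHom hst) ≫ groundedPush K hcol hshift t =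
        groundedPush K hcol hshift s ≫
          groundedInclusion K H (add_le_add_left (leOfHom hst) δ) := rfl
    have hhomology := congrArg (HomologicalComplex.homologyMap · 1) hchain
    simp only [HomologicalComplex.homologyMap_comp] at hhomology
    exact hhomology

variable {f : V → W} {g : W → V}

theorem push_push_sub_mem_map_bd (hf_col : G.IsPathCollapsing f) (hg_col : H.IsPathCollapsing g)
    (hf_shift : IsShifting G H δ f) (hg_shift : IsShifting H G δ g)
    (hcod : GroundedCodistortionLE G g f δ) {t : ℝ≥0} {c : Lam K V 1}
    (hc : c ∈ groundedChains K G t 1) (hz : bd K V 0 c = 0) :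
    push K g 1 (push K f 1 c) - c ∈ (groundedChains K G (t + δ + δ) 2).map (bd K V 1) := by
  obtain ⟨h, hG⟩ := hcod.exists_homotopyDefect_mem K
  have htwo (s : ℝ≥0) : groundedChains K G s 2 = pathChains K (dFl (G.SP s)) 2 := Omega_dFl K _ 2
  have hle : (t : ℝ) ≤ ↑(t + δ + δ) := NNReal.coe_le_coe.2 (le_self_add.trans le_self_add)
  have hδ : (2 * δ : ℝ) ≤ ↑(t + δ + δ) := by
    push_cast
    linarith [t.coe_nonneg]
  rw [htwo, push_push]
  refine push_sub_mem_triangleBoundaries K hle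
    (hG.trans (Submodule.comap_mono (triangleBoundaries_mono K (G.SP_mono hδ))))
    (fun b hb => ?_) ((Omega_dFl K _ 1).le hc) hz
  rw [← htwo] at hb ⊢
  rw [← push_push]
  exact push_mem_groundedChains K hg_col hg_shift _ 2 _
    (push_mem_groundedChains K hf_col hf_shift t 2 b hb)

theorem groundedHomologyPush_comp (hf_col : G.IsPathCollapsing f) (hg_col : H.IsPathCollapsing g)
    (hf_shift : IsShifting G H δ f) (hg_shift : IsShifting H G δ g)
    (hcod : GroundedCodistortionLE G g f δ) (t : ℝ≥0) :
    (groundedHomologyPush K hf_col hf_shift).app t ≫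
        (groundedHomologyPush K hg_col hg_shift).app (t + δ) =
      (groundedHomology K G).map (homOfLE (le_self_add.trans le_self_add : t ≤ t + δ + δ)) := by
  change HomologicalComplex.homologyMap (groundedPush K hf_col hf_shift t) 1 ≫
      HomologicalComplex.homologyMap (groundedPush K hg_col hg_shift (t + δ)) 1 =
    HomologicalComplex.homologyMap (groundedInclusion K G (le_self_add.trans le_self_add)) 1
  rw [← HomologicalComplex.homologyMap_comp]
  refine homologyMap_eq_of_forall_cycle _ _ 2 1 0 fun z hz => ?_
  rw [groundedComplex_d] at hz ⊢
  have hcycle : bd K V 0 z.1 = 0 := congrArg Subtype.val hz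
  obtain ⟨w, hw, hwz⟩ :=
    push_push_sub_mem_map_bd K hf_col hg_col hf_shift hg_shift hcod z.2 hcycle
  exact ⟨⟨w, hw⟩, Subtype.ext hwz⟩

theorem IsGroundedInterleaving.isInterleaved (h : IsGroundedInterleaving G H δ f g) :
    IsInterleaved (groundedHomology K G) (groundedHomology K H) δ :=
  ⟨groundedHomologyPush K h.pathCollapsing_left h.shifting_left,
    groundedHomologyPush K h.pathCollapsing_right h.shifting_right,
    groundedHomologyPush_comp K h.pathCollapsing_left h.pathCollapsing_right h.shifting_left
      h.shifting_right h.codistortion_left,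
    groundedHomologyPush_comp K h.pathCollapsing_right h.pathCollapsing_left h.shifting_right
      h.shifting_left h.codistortion_right⟩

end Grounded

end WDigraph

end GroundedFlag

end

theorem mainTheorem12 {K : Type v} [Field K] {V W : Type u}
    (G : GroundedFlag.WDigraph V) (H : GroundedFlag.WDigraph W) (δ : ℝ≥0)
    (h : ∃ (f : V → W) (g : W → V), GroundedFlag.WDigraph.IsGroundedInterleaving G H δ f g) :
    GroundedFlag.interleavingDist (GroundedFlag.WDigraph.groundedHomology K G)
      (GroundedFlag.WDigraph.groundedHomology K H) ≤ (δ : ℝ≥0∞) := by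
  obtain ⟨f, g, hfg⟩ := h
  exact iInf₂_le δ (hfg.isInterleaved K)
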